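/- Let $n\in\mathbb N=\{0,1,2,\dots\}$ and $\mathbf n=\{1,\dots,n\}$. The partition monoid $\mathcal P_n$ is the set of all set partitions (into non-empty blocks) of $\mathbf n\cup\mathbf n'$, where $\mathbf n'=\{1',\dots,n'\}$ is a disjoint copy of $\mathbf n$. The product $\alpha\beta$ is formed by drawing $\alpha$ on $\mathbf n\cup\mathbf n''$ and $\beta$ on $\mathbf n''\cup\mathbf n'$ (with $\mathbf n''$ a third copy of $\mathbf n$): two elements of $\mathbf n\cup\mathbf n'$ lie in the same block of $\alpha\beta$ if and only if they are joined by a path in the resulting graph on $\mathbf n\cup\mathbf n''\cup\mathbf n'$. The Brauer monoid $\mathcal B_n$ (respectively, the partial Brauer monoid $\mathcal{PB}_n$) consists of all $\alpha\in\mathcal P_n$ whose blocks all have size exactly $2$ (respectively, at most $2$). For $\alpha\in\mathcal P_n$, $\operatorname{rank}(\alpha)$ is the number of blocks meeting both $\mathbf n$ and $\mathbf n'$. The kernel $\ker(\alpha)$ is the join (smallest common upper bound) of the two equivalence relations $\{(x,y): x,y \text{ lie in the same block of }\alpha\}$ and $\{(x,y): x',y'\text{ lie in the same block of }\alpha\}$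 on $\mathbf n$; $\alpha$ is irreducible if $\ker(\alpha)=\mathbf n\times\mathbf n$. An integer partition $\mu\vdash n$ is written $\mu=(m_1,\dots,m_k)$ with $m_1\ge\cdots\ge m_k\ge1$ and $m_1+\cdots+m_k=n$, or $\mu=(1^{\mu_1},\dots,n^{\mu_n})$, where $\mu_i$ is the number of $j$ with $m_j=i$. The type of a set partition of $\mathbf n$ is the integer partition of $n$ formed by the sizes of its parts, $\pi(\mu)$ is the number of set partitions of $\mathbf n$ of type $\mu$, and $\mu(\alpha)$ is the type of the set partition of $\mathbf n$ into the classes of $\ker(\alpha)$. Let $\mathcal K$ be one of $\mathcal P,\mathcal B,\mathcal{PB}$ and let $0\le r\le n$. Write $D_r(\mathcal K_n)=\{\alpha\in\mathcal K_n:\operatorname{rank}(\alpha)=r\}$, let $e(D_r(\mathcal K_n))$ be the number of idempotents in $D_r(\mathcal K_n)$, let $e_\mu(D_r(\mathcal K_n))$ be the number of idempotents $\alpha$ in $D_r(\mathcal K_n)$ with $\mu(\alpha)=\mu$, and, for $s\in\{0,1\}$ and $m\ge1$, let $c_s(\mathcal K_m)$ be the number of irreducible idempotents of rank $s$ in $\mathcal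 K_m$. Then $$e(D_r(\mathcal K_n))=\sum_{\mu\vdash n}e_\mu(D_r(\mathcal K_n)),$$ and for every $\mu=(m_1,\dots,m_k)=(1^{\mu_1},\dots,n^{\mu_n})\vdash n$, $$e_\mu(D_r(\mathcal K_n))=\frac{n!}{\prod_{i=1}^n\mu_i!\,(i!)^{\mu_i}}\sum_{\substack{A\subseteq\{1,\dots,k\}\\|A|=r}}\Bigl(\prod_{i\in A}c_1(\mathcal K_{m_i})\cdot\prod_{j\in\{1,\dots,k\}\setminus A}c_0(\mathcal K_{m_j})\Bigr),\qquad \pi(\mu)=\frac{n!}{\prod_{i=1}^n\mu_i!\,(i!)^{\mu_i}}.$$ -/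

import Mathlib

/-- The partition monoid on `X`: a set partition of the disjoint union of `X` (the upper vertices
`Sum.inl x`) and a copy `X'` of `X` (the lower vertices `x' = Sum.inr x`), encoded as the
equivalence relation whose classes are the blocks. -/
def PartitionMonoid (X : Type*) : Type _ := Setoid (X ⊕ X)

namespace PartitionMonoid

variable {X : Type*}

/-- `α.SameBlock x y`: the vertices `x` and `y` lie in the same block of `α`. -/
def SameBlock (α : PartitionMonoid X) (x y : X ⊕ X) : Prop := Setoid.r (self := α) x y

/-- The set of blocks of `α`. -/
def blocks (α : PartitionMonoid X) : Set (Set (X ⊕ X)) := Setoid.classes α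

/-- The product graph `Γ(α, β)`. Its vertex set `X ⊕ (X ⊕ X)` consists of the top copy
`x = Sum.inl x`, the middle copy `x'' = Sum.inr (Sum.inl x)` and the bottom copy
`x' = Sum.inr (Sum.inr x)`. The diagram of `α` is drawn between top and middle, the diagram
of `β` between middle and bottom; any two vertices of a block are joined by an edge. -/
def productGraph (α β : PartitionMonoid X) : SimpleGraph (X ⊕ (X ⊕ X)) :=
  SimpleGraph.fromRel fun p q =>
    (∃ x y, α.SameBlock x y ∧ p = Sum.map id Sum.inl x ∧ q = Sum.map id Sum.inl y) ∨
    (∃ x y, β.SameBlock x y ∧ p = Sum.inr x ∧ q = Sum.inr y)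

/-- The product `α * β`: two vertices of `X ∪ X'` are in the same block iff they are joined by a
path in the product graph. -/
instance : Mul (PartitionMonoid X) where
  mul α β := Setoid.comap (Sum.map id Sum.inr) (productGraph α β).reachableSetoid

theorem sameBlock_mul_iff (α β : PartitionMonoid X) (x y : X ⊕ X) :
    (α * β).SameBlock x y ↔
      (productGraph α β).Reachable (Sum.map id Sum.inr x) (Sum.map id Sum.inr y) :=
  Iff.rfl

/-- A block is transversal if it meets both `X` and `X'`. -/
def IsTransversal (A : Set (X ⊕ X)) : Prop :=
  (∃ x : X, Sum.inl x ∈ A) ∧ (∃ x : X, Sum.inr x ∈ A)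

/-- The rank: the number of transversal blocks (used for finite `X`). -/
noncomputable def rank (α : PartitionMonoid X) : ℕ :=
  {A ∈ α.blocks | IsTransversal A}.ncard

/-- The upper kernel. -/
def upperKer (α : PartitionMonoid X) : Setoid X := Setoid.comap Sum.inl α

/-- The lower kernel. -/
def lowerKer (α : PartitionMonoid X) : Setoid X := Setoid.comap Sum.inr α

/-- The kernel: the join of the upper and the lower kernel. -/
def ker (α : PartitionMonoid X) : Setoid X := α.upperKer ⊔ α.lowerKer

/-- `α` is irreducible if its kernel is the universal relation. -/
def IsIrreducible (α : PartitionMonoid X) : Prop := α.ker = ⊤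

/-- All partitions on `{1, …, n}` (modelled by `Fin n`). -/
def P (n : ℕ) : Set (PartitionMonoid (Fin n)) := Set.univ

/-- The Brauer monoid: each block has size `2`. -/
def B (n : ℕ) : Set (PartitionMonoid (Fin n)) := {α | ∀ A ∈ α.blocks, A.ncard = 2}

/-- The partial Brauer monoid: each block has size at most `2`. -/
def PB (n : ℕ) : Set (PartitionMonoid (Fin n)) := {α | ∀ A ∈ α.blocks, A.ncard ≤ 2}

/-- `D r S`: the elements of `S` of rank `r`. -/
def D (r : ℕ) (S : Set (PartitionMonoid X)) : Set (PartitionMonoid X) := {α ∈ S | α.rank = r}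

/-- `E S`: the idempotents of `S`. -/
def E (S : Set (PartitionMonoid X)) : Set (PartitionMonoid X) := {α ∈ S | α * α = α}

/-- `e S`: the number of idempotents of `S`. -/
noncomputable def e (S : Set (PartitionMonoid X)) : ℕ := (E S).ncard

/-- `C r S`: the irreducible idempotents of `S` of rank `r`. -/
def C (r : ℕ) (S : Set (PartitionMonoid X)) : Set (PartitionMonoid X) :=
  {α ∈ E S | α.IsIrreducible ∧ α.rank = r}

/-- `c r S`: the number of irreducible idempotents of `S` of rank `r`. -/
noncomputable def c (r : ℕ) (S : Set (PartitionMonoid X)) : ℕ := (C r S).ncard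

/-- The type of a set partition of `{1, …, n}`: the integer partition of `n` formed by the sizes
of its parts. -/
def setPartitionType {n : ℕ} (Q : Finpartition (Finset.univ : Finset (Fin n))) : n.Partition where
  parts := Q.parts.val.map Finset.card
  parts_pos := by
    intro i hi
    obtain ⟨s, hs, rfl⟩ := Multiset.mem_map.1 hi
    exact Finset.card_pos.2 (Q.nonempty_of_mem_parts hs)
  parts_sum := by
    have h := Q.sum_card_parts
    rw [Finset.card_univ, Fintype.card_fin] at h
    exact h

/-- `π(μ)`: the number of set partitions of `{1, …, n}` of type `μ`. -/
noncomputable def numSetPartitions {n : ℕ} (μ : n.Partition) : ℕ :=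
  {Q : Finpartition (Finset.univ : Finset (Fin n)) | setPartitionType Q = μ}.ncard

open Classical in
/-- The type `μ(α)`: the integer partition formed by the sizes of the kernel-classes of `α`. -/
noncomputable def kerType {n : ℕ} (α : PartitionMonoid (Fin n)) : n.Partition :=
  setPartitionType (Finpartition.ofSetoid α.ker)

/-- `eType μ S`: the number of idempotents of `S` with kernel type `μ`. -/
noncomputable def eType {n : ℕ} (μ : n.Partition) (S : Set (PartitionMonoid (Fin n))) : ℕ :=
  {α ∈ E S | α.kerType = μ}.ncard

end PartitionMonoid

/-! By `mul_self_eq_iff`, `α` is idempotent iff every block lies over one class of `α.ker` and every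
class carries at most one transversal block. Both conditions can be tested class by class. An
idempotent with a prescribed kernel is therefore an independent choice of an irreducible idempotent
on each kernel class (`bijOn_restrict`). Gluing preserves block sizes, which is all that
distinguishes the three monoids, and ranks add up.

An irreducible idempotent has rank 0 or 1, so rank `r` means choosing the `r` classes that carry a
transversal block. This gives the inner sum (`ncard_families`), which depends only on the class
sizes. Each set partition of type `μ` thus contributes the same number, and the total is `π(μ)`
times it (`eType_eq`).

For `π(μ)`, count labelled set partitions: by orbit–stabilizer there are `n! / ∏ m_i!` functions
with fibre sizes `m_i`, and each set partition of type `μ` arises from `∏ μ_i!` of them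
(`numSetPartitions_mul`). -/

namespace PartitionMonoid

/-! ### Paths in the product graph and a criterion for idempotency -/

variable {X : Type*}

theorem SameBlock.refl (α : PartitionMonoid X) (a : X ⊕ X) : α.SameBlock a a := Setoid.refl' α a

theorem SameBlock.symm {α : PartitionMonoid X} {a b : X ⊕ X} (h : α.SameBlock a b) :
    α.SameBlock b a := Setoid.symm' α h

theorem SameBlock.trans {α : PartitionMonoid X} {a b c : X ⊕ X} (h : α.SameBlock a b)
    (h' : α.SameBlock b c) : α.SameBlock a c := Setoid.trans' α h h'

theorem ext_sameBlock {α β : PartitionMonoid X}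
    (h : ∀ a b, α.SameBlock a b ↔ β.SameBlock a b) : α = β := Setoid.ext h

theorem ker_of_inl {α : PartitionMonoid X} {x y : X} (h : α.SameBlock (.inl x) (.inl y)) :
    α.ker x y := (le_sup_left : α.upperKer ≤ α.ker) h

theorem ker_of_inr {α : PartitionMonoid X} {x y : X} (h : α.SameBlock (.inr x) (.inr y)) :
    α.ker x y := (le_sup_right : α.lowerKer ≤ α.ker) h

theorem ker_le {α : PartitionMonoid X} {s : Setoid X}
    (h₁ : ∀ x y, α.SameBlock (.inl x) (.inl y) → s x y)
    (h₂ : ∀ x y, α.SameBlock (.inr x) (.inr y) → s x y) : α.ker ≤ s :=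
  sup_le (fun {x y} h => h₁ x y h) (fun {x y} h => h₂ x y h)

/-- A property of the vertices of the product graph that is inherited along the blocks of both
factors is inherited along paths. -/
theorem reachable_induction {α β : PartitionMonoid X} (f : X ⊕ (X ⊕ X) → Prop)
    (h₁ : ∀ x y, α.SameBlock x y → f (Sum.map id Sum.inl x) → f (Sum.map id Sum.inl y))
    (h₂ : ∀ x y, β.SameBlock x y → f (Sum.inr x) → f (Sum.inr y)) {p q : X ⊕ (X ⊕ X)}
    (h : (productGraph α β).Reachable p q) (hp : f p) : f q := by
  obtain ⟨w⟩ := h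
  induction w with
  | nil => exact hp
  | cons hadj _ ih =>
    apply ih
    rw [productGraph, SimpleGraph.fromRel_adj] at hadj
    rcases hadj.2 with (⟨x, y, h, rfl, rfl⟩ | ⟨x, y, h, rfl, rfl⟩) |
      (⟨x, y, h, rfl, rfl⟩ | ⟨x, y, h, rfl, rfl⟩)
    · exact h₁ _ _ h hp
    · exact h₂ _ _ h hp
    · exact h₁ _ _ h.symm hp
    · exact h₂ _ _ h.symm hp

theorem reachable_of_left {α β : PartitionMonoid X} {x y : X ⊕ X} (h : α.SameBlock x y) :
    (productGraph α β).Reachable (Sum.map id Sum.inl x) (Sum.map id Sum.inl y) := by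
  by_cases hxy : Sum.map id (Sum.inl : X → X ⊕ X) x = Sum.map id Sum.inl y
  · rw [hxy]
  · exact SimpleGraph.Adj.reachable
      ((SimpleGraph.fromRel_adj _ _ _).2 ⟨hxy, .inl (.inl ⟨x, y, h, rfl, rfl⟩)⟩)

theorem reachable_of_right {α β : PartitionMonoid X} {x y : X ⊕ X} (h : β.SameBlock x y) :
    (productGraph α β).Reachable (Sum.inr x) (Sum.inr y) := by
  by_cases hxy : (Sum.inr x : X ⊕ (X ⊕ X)) = Sum.inr y
  · rw [hxy]
  · exact SimpleGraph.Adj.reachable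
      ((SimpleGraph.fromRel_adj _ _ _).2 ⟨hxy, .inl (.inr ⟨x, y, h, rfl, rfl⟩)⟩)

/-- On the middle row the upper copy of `α` draws its lower kernel and the lower copy its upper
kernel, so together they connect whole classes of the join. -/
theorem reachable_of_ker {α : PartitionMonoid X} {x y : X} (h : α.ker x y) :
    (productGraph α α).Reachable (Sum.inr (Sum.inl x)) (Sum.inr (Sum.inl y)) :=
  ker_le (s := (productGraph α α).reachableSetoid.comap fun x => Sum.inr (Sum.inl x))
    (fun _ _ h => reachable_of_right h) (fun _ _ h => reachable_of_left h) h

/-- The element of `X` underlying a vertex. -/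
def proj : X ⊕ X → X := Sum.elim id id

/-- `α` is idempotent iff each block lies over a single kernel class, and each kernel class
carries at most one transversal block. -/
theorem mul_self_eq_iff (α : PartitionMonoid X) : α * α = α ↔
    (∀ a b, α.SameBlock a b → α.ker (proj a) (proj b)) ∧
    ∀ x y z w, α.SameBlock (.inl x) (.inr y) → α.SameBlock (.inl z) (.inr w) → α.ker x z →
      α.SameBlock (.inl x) (.inl z) := by
  constructor
  · intro h
    have hm : ∀ a b, α.SameBlock a b ↔
        (productGraph α α).Reachable (Sum.map id Sum.inr a) (Sum.map id Sum.inr b) := by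
      intro a b
      rw [← sameBlock_mul_iff, h]
    -- Follow a path from `x` to `y'`. Invariant: a middle vertex is in the kernel class of `y`, and
    -- an outer vertex shares a block with a vertex of the opposite row over that class. At `y'`
    -- this yields `v` with `x`, `v` in one block and `v` related to `y`.
    have key : ∀ x y, α.SameBlock (.inl x) (.inr y) → α.ker x y := by
      intro x y hxy
      have := reachable_induction (α := α) (β := α)
        (Sum.elim (fun z => ∃ u, α.SameBlock (.inl z) (.inr u) ∧ α.ker u y)
          (Sum.elim (fun u => α.ker u y) fun z => ∃ v, α.SameBlock (.inl v) (.inr z) ∧ α.ker v y))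
        ?_ ?_ ((hm _ _).1 hxy) ⟨y, hxy, Setoid.refl' _ _⟩
      · obtain ⟨v, hv, hv'⟩ := this
        exact Setoid.trans' _ (ker_of_inl (hxy.trans hv.symm)) hv'
      · rintro (a | a) (b | b) hab
        · rintro ⟨u, hu, hu'⟩
          exact ⟨u, hab.symm.trans hu, hu'⟩
        · rintro ⟨u, hu, hu'⟩
          exact Setoid.trans' _ (ker_of_inr (hab.symm.trans hu)) hu'
        · intro ha
          exact ⟨a, hab.symm, ha⟩
        · intro ha
          exact Setoid.trans' _ (ker_of_inr hab.symm) ha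
      · rintro (a | a) (b | b) hab
        · intro ha
          exact Setoid.trans' _ (ker_of_inl hab.symm) ha
        · intro ha
          exact ⟨a, hab, ha⟩
        · rintro ⟨v, hv, hv'⟩
          exact Setoid.trans' _ (ker_of_inl (hab.symm.trans hv.symm)) hv'
        · rintro ⟨v, hv, hv'⟩
          exact ⟨v, hv.trans hab, hv'⟩
    refine ⟨?_, fun x y z w hxy hzw hxz => ?_⟩
    · rintro (a | a) (b | b) hab
      · exact ker_of_inl hab
      · exact key _ _ hab
      · exact Setoid.symm' _ (key _ _ hab.symm)
      · exact ker_of_inr hab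
    -- The path goes from `x` down to `y''`, along the middle row to `w''`, and up to `z`.
    · rw [hm]
      have hyw : α.ker y w := Setoid.trans' _ (Setoid.symm' _ (key _ _ hxy))
        (Setoid.trans' _ hxz (key _ _ hzw))
      exact (reachable_of_left hxy).trans
        ((reachable_of_ker hyw).trans (reachable_of_left hzw.symm))
  · rintro ⟨hloc, hmerge⟩
    -- The path is `x`, `y''`, `x''`, `y'`; its middle step exists because the block lies over one
    -- kernel class.
    have cross : ∀ x y, α.SameBlock (.inl x) (.inr y) →
        (productGraph α α).Reachable (.inl x) (.inr (.inr y)) := fun x y h =>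
      (reachable_of_left h).trans ((reachable_of_ker (Setoid.symm' _ (hloc _ _ h))).trans
        (reachable_of_right h))
    -- Two transversal blocks over the same kernel class coincide, whichever vertices represent
    -- them.
    have merge' : ∀ a b x y z w, α.SameBlock a (.inl x) → α.SameBlock a (.inr y) →
        α.SameBlock b (.inl z) → α.SameBlock b (.inr w) → α.ker (proj a) (proj b) →
        α.SameBlock a b := by
      intro a b x y z w hx hy hz hw hab
      refine hx.trans ((hmerge x y z w (hx.symm.trans hy) (hz.symm.trans hw) ?_).trans hz.symm)
      exact Setoid.trans' _ (Setoid.symm' _ (hloc _ _ hx)) (Setoid.trans' _ hab (hloc _ _ hz))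
    refine ext_sameBlock fun a b => ?_
    rw [sameBlock_mul_iff]
    constructor
    · intro h
      -- Invariant: outer vertices reached from `a` lie in its block, and the middle row is reached
      -- only if that block is transversal, and then only within its kernel class. Leaving the
      -- middle through another transversal block is excluded by `merge'`.
      have := reachable_induction (α := α) (β := α)
        (Sum.elim (fun z => α.SameBlock a (.inl z))
          (Sum.elim (fun u => (∃ x y, α.SameBlock a (.inl x) ∧ α.SameBlock a (.inr y)) ∧
            α.ker (proj a) u) fun z => α.SameBlock a (.inr z)))
        ?_ ?_ h ?_
      · cases b <;> exact this
      · rintro (c | c) (d | d) hcd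
        · intro h
          exact h.trans hcd
        · intro h
          exact ⟨⟨c, d, h, h.trans hcd⟩, hloc _ _ (h.trans hcd)⟩
        · rintro ⟨⟨x, y, hx, hy⟩, hc⟩
          exact merge' _ _ x y d c hx hy (SameBlock.refl _ _) hcd.symm
            (Setoid.trans' _ hc (hloc _ _ hcd))
        · rintro ⟨h, hc⟩
          exact ⟨h, Setoid.trans' _ hc (ker_of_inr hcd)⟩
      · rintro (c | c) (d | d) hcd
        · rintro ⟨h, hc⟩
          exact ⟨h, Setoid.trans' _ hc (ker_of_inl hcd)⟩
        · rintro ⟨⟨x, y, hx, hy⟩, hc⟩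
          exact merge' _ _ x y c d hx hy hcd.symm (SameBlock.refl _ _)
            (Setoid.trans' _ hc (hloc _ _ hcd))
        · intro h
          exact ⟨⟨d, c, h.trans hcd, h⟩, hloc _ _ (h.trans hcd)⟩
        · intro h
          exact h.trans hcd
      · cases a <;> exact SameBlock.refl _ _
    · intro h
      rcases a with a | a <;> rcases b with b | b
      · exact reachable_of_left h
      · exact cross _ _ h
      · exact (cross _ _ h.symm).symm
      · exact reachable_of_right h

end PartitionMonoid
-- Decomposition of idempotents along their kernel classes
namespace PartitionMonoid

/-- The partitions all of whose blocks have size in `T`. -/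
def blockSizesIn (T : Set ℕ) (X : Type*) : Set (PartitionMonoid X) :=
  {α | ∀ A ∈ α.blocks, A.ncard ∈ T}

/-- The disjoint union of a family of equivalence relations. -/
def sigmaSetoid {ι : Type*} {Z : ι → Type*} (s : ∀ i, Setoid (Z i)) : Setoid (Σ i, Z i) :=
  Setoid.ker fun z => (⟨z.1, Quotient.mk (s z.1) z.2⟩ : Σ i, Quotient (s i))

theorem sigmaSetoid_fst {ι : Type*} {Z : ι → Type*} {s : ∀ i, Setoid (Z i)} {a b : Σ i, Z i}
    (h : sigmaSetoid s a b) : a.1 = b.1 := by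
  rw [sigmaSetoid, Setoid.ker_def] at h
  exact (Sigma.mk.inj_iff.1 h).1

theorem sigmaSetoid_mk {ι : Type*} {Z : ι → Type*} (s : ∀ i, Setoid (Z i)) (i : ι) (a b : Z i) :
    sigmaSetoid s ⟨i, a⟩ ⟨i, b⟩ ↔ s i a b := by
  rw [sigmaSetoid, Setoid.ker_def]
  simp only [Sigma.mk.injEq, heq_eq_eq, true_and]
  exact Quotient.eq

section Decomposition

variable {X ι : Type*} {Y : ι → Type*} (e : X ≃ Σ i, Y i)

/-- The equivalence relation whose classes are the fibres of `X ≃ Σ i, Y i`. -/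
def fibreSetoid : Setoid X := Setoid.ker fun x => (e x).1

/-- The inclusion of the vertices over the summand `Y i`. -/
def vertexMap (i : ι) : Y i ⊕ Y i → X ⊕ X :=
  Sum.map (fun y => e.symm ⟨i, y⟩) (fun y => e.symm ⟨i, y⟩)

/-- The decomposition of the vertices over the summands. -/
def vertexEquiv : X ⊕ X ≃ Σ i, Y i ⊕ Y i :=
  (Equiv.sumCongr e e).trans (Equiv.sigmaSumDistrib Y Y).symm

/-- The restriction of a partition to the vertices over `Y i`. -/
def restrict (α : PartitionMonoid X) (i : ι) : PartitionMonoid (Y i) :=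
  Setoid.comap (vertexMap e i) α

/-- The disjoint union of partitions over the `Y i`. -/
def glue (β : ∀ i, PartitionMonoid (Y i)) : PartitionMonoid X :=
  Setoid.comap (vertexEquiv e) (sigmaSetoid β)

/-- Each block lies over a single summand. -/
def IsLocal (α : PartitionMonoid X) : Prop :=
  ∀ a b, α.SameBlock a b → (e (proj a)).1 = (e (proj b)).1

variable {e}

theorem restrict_sameBlock {α : PartitionMonoid X} {i : ι} {a b : Y i ⊕ Y i} :
    (restrict e α i).SameBlock a b ↔ α.SameBlock (vertexMap e i a) (vertexMap e i b) := Iff.rfl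

theorem glue_sameBlock {β : ∀ i, PartitionMonoid (Y i)} {a b : X ⊕ X} :
    (glue e β).SameBlock a b ↔ sigmaSetoid β (vertexEquiv e a) (vertexEquiv e b) := Iff.rfl

theorem vertexEquiv_vertexMap (i : ι) (a : Y i ⊕ Y i) :
    vertexEquiv e (vertexMap e i a) = ⟨i, a⟩ := by
  cases a <;> simp [vertexEquiv, vertexMap, Equiv.sigmaSumDistrib, Sigma.map]

theorem fst_proj_vertexMap (i : ι) (a : Y i ⊕ Y i) : (e (proj (vertexMap e i a))).1 = i := by
  cases a <;> simp [vertexMap, proj]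

theorem vertexEquiv_fst (a : X ⊕ X) : (vertexEquiv e a).1 = (e (proj a)).1 := by
  cases a <;> simp [vertexEquiv, proj, Equiv.sigmaSumDistrib, Sigma.map]

theorem exists_vertexMap (a : X ⊕ X) : ∃ i b, vertexMap e i b = a :=
  ⟨_, (vertexEquiv e a).2, (vertexEquiv e).injective (by rw [vertexEquiv_vertexMap])⟩

theorem vertexMap_injective (i : ι) : Function.Injective (vertexMap e i) := by
  intro a b h
  have := congrArg (vertexEquiv e) h
  simpa [vertexEquiv_vertexMap] using this

theorem restrict_glue (β : ∀ i, PartitionMonoid (Y i)) (i : ι) : restrict e (glue e β) i = β i := by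
  refine ext_sameBlock fun a b => ?_
  rw [restrict_sameBlock, glue_sameBlock, vertexEquiv_vertexMap, vertexEquiv_vertexMap]
  exact sigmaSetoid_mk (fun i => (β i : Setoid (Y i ⊕ Y i))) i a b

theorem isLocal_glue (β : ∀ i, PartitionMonoid (Y i)) : IsLocal e (glue e β) := by
  intro a b h
  rw [← vertexEquiv_fst, ← vertexEquiv_fst]
  exact sigmaSetoid_fst h

theorem IsLocal.eq_of_restrict {α β : PartitionMonoid X} (hα : IsLocal e α) (hβ : IsLocal e β)
    (h : ∀ i, restrict e α i = restrict e β i) : α = β := by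
  refine ext_sameBlock fun a b => ?_
  obtain ⟨i, a, rfl⟩ := exists_vertexMap (e := e) a
  obtain ⟨j, b, rfl⟩ := exists_vertexMap (e := e) b
  by_cases hij : i = j
  · subst hij
    rw [← restrict_sameBlock, ← restrict_sameBlock, h]
  · constructor
    · intro h
      exact absurd (by simpa [fst_proj_vertexMap] using hα _ _ h) hij
    · intro h
      exact absurd (by simpa [fst_proj_vertexMap] using hβ _ _ h) hij

theorem IsLocal.ker_le {α : PartitionMonoid X} (hα : IsLocal e α) : α.ker ≤ fibreSetoid e :=
  PartitionMonoid.ker_le (fun _ _ h => hα _ _ h) fun _ _ h => hα _ _ h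

/-- The kernel of a local partition is the disjoint union of the kernels of its restrictions, so it
fills every fibre exactly when each of these is universal. -/
theorem IsLocal.ker_eq_iff {α : PartitionMonoid X} (hα : IsLocal e α) :
    α.ker = fibreSetoid e ↔ ∀ i, (restrict e α i).IsIrreducible := by
  constructor
  · intro h i
    have hle : α.ker ≤ (sigmaSetoid fun i => (restrict e α i).ker).comap e := by
      refine PartitionMonoid.ker_le (fun x y h => ?_) (fun x y h => ?_)
      all_goals
        have hxy := hα _ _ h
        obtain ⟨⟨i, a⟩, rfl⟩ := e.symm.surjective x
        obtain ⟨⟨j, b⟩, rfl⟩ := e.symm.surjective y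
        simp only [proj, Sum.elim_inl, Sum.elim_inr, id, Equiv.apply_symm_apply] at hxy
        subst hxy
        rw [Setoid.comap_rel, e.apply_symm_apply, e.apply_symm_apply, sigmaSetoid_mk]
      · exact ker_of_inl h
      · exact ker_of_inr h
    refine Setoid.eq_top_iff.2 fun a b => ?_
    have h₁ : α.ker (e.symm ⟨i, a⟩) (e.symm ⟨i, b⟩) := by
      rw [h, fibreSetoid, Setoid.ker_def]
      simp
    have h₂ := hle h₁
    rwa [Setoid.comap_rel, e.apply_symm_apply, e.apply_symm_apply, sigmaSetoid_mk] at h₂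
  · intro h
    refine le_antisymm hα.ker_le fun x y hxy => ?_
    obtain ⟨⟨i, a⟩, rfl⟩ := e.symm.surjective x
    obtain ⟨⟨j, b⟩, rfl⟩ := e.symm.surjective y
    rw [fibreSetoid, Setoid.ker_def] at hxy
    simp only [Equiv.apply_symm_apply] at hxy
    subst hxy
    have hle : (restrict e α i).ker ≤ α.ker.comap fun y => e.symm ⟨i, y⟩ :=
      PartitionMonoid.ker_le (fun _ _ h => ker_of_inl h) (fun _ _ h => ker_of_inr h)
    exact hle (Setoid.eq_top_iff.1 (h i) a b)

theorem isLocal_of_mul_self {α : PartitionMonoid X} (hα : α * α = α)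
    (hk : α.ker = fibreSetoid e) : IsLocal e α := by
  intro a b h
  have := ((mul_self_eq_iff α).1 hα).1 a b h
  rwa [hk] at this

/-- Locality is the first condition of `mul_self_eq_iff`; the second only compares transversal
blocks over one kernel class, that is, over one summand. -/
theorem IsLocal.mul_self_iff {α : PartitionMonoid X} (hα : IsLocal e α)
    (hk : α.ker = fibreSetoid e) :
    α * α = α ↔ ∀ i, restrict e α i * restrict e α i = restrict e α i := by
  have hirr := hα.ker_eq_iff.1 hk
  have htop : ∀ i a b, (restrict e α i).ker a b := fun i a b => Setoid.eq_top_iff.1 (hirr i) a b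
  rw [mul_self_eq_iff]
  constructor
  · rintro ⟨-, h⟩ i
    rw [mul_self_eq_iff]
    refine ⟨fun a b _ => htop _ _ _, fun x y z w hxy hzw _ => ?_⟩
    refine h _ _ _ _ hxy hzw ?_
    rw [hk, fibreSetoid, Setoid.ker_def]
    simp
  · intro h
    refine ⟨fun a b hab => ?_, fun x y z w hxy hzw hxz => ?_⟩
    · rw [hk]
      exact hα _ _ hab
    · have h₁ := hα _ _ hxy
      have h₂ := hα _ _ hzw
      rw [hk, fibreSetoid, Setoid.ker_def] at hxz
      obtain ⟨⟨i, x⟩, rfl⟩ := e.symm.surjective x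
      obtain ⟨⟨j, y⟩, rfl⟩ := e.symm.surjective y
      obtain ⟨⟨k, z⟩, rfl⟩ := e.symm.surjective z
      obtain ⟨⟨l, w⟩, rfl⟩ := e.symm.surjective w
      simp only [proj, Sum.elim_inl, Sum.elim_inr, id, Equiv.apply_symm_apply] at h₁ h₂ hxz
      subst h₁ h₂ hxz
      exact ((mul_self_eq_iff _).1 (h i)).2 x y z w hxy hzw (htop _ _ _)

theorem IsLocal.blocks_eq {α : PartitionMonoid X} (hα : IsLocal e α) :
    α.blocks = ⋃ i, (vertexMap e i '' ·) '' (restrict e α i).blocks := by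
  have key : ∀ i (a : Y i ⊕ Y i), {x | α.SameBlock x (vertexMap e i a)} =
      vertexMap e i '' {x | (restrict e α i).SameBlock x a} := by
    intro i a
    ext x
    constructor
    · intro hx
      obtain ⟨j, b, rfl⟩ := exists_vertexMap (e := e) x
      have := hα _ _ hx
      rw [fst_proj_vertexMap, fst_proj_vertexMap] at this
      subst this
      exact ⟨b, hx, rfl⟩
    · rintro ⟨b, hb, rfl⟩
      exact hb
  ext A
  simp only [Set.mem_iUnion, Set.mem_image]
  constructor
  · rintro ⟨y, rfl⟩
    obtain ⟨i, a, rfl⟩ := exists_vertexMap (e := e) y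
    exact ⟨i, _, ⟨a, rfl⟩, (key i a).symm⟩
  · rintro ⟨i, _, ⟨a, rfl⟩, rfl⟩
    exact ⟨vertexMap e i a, (key i a).symm⟩

theorem IsLocal.mem_blockSizesIn {α : PartitionMonoid X} (hα : IsLocal e α) (T : Set ℕ) :
    α ∈ blockSizesIn T X ↔ ∀ i, restrict e α i ∈ blockSizesIn T (Y i) := by
  simp only [blockSizesIn, Set.mem_ofPred_eq, hα.blocks_eq, Set.mem_iUnion, Set.mem_image]
  constructor
  · intro h i A hA
    have := h _ ⟨i, A, hA, rfl⟩
    rwa [Set.ncard_image_of_injective _ (vertexMap_injective i)] at this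
  · rintro h _ ⟨i, A, hA, rfl⟩
    rw [Set.ncard_image_of_injective _ (vertexMap_injective i)]
    exact h i A hA

theorem isTransversal_image (i : ι) (A : Set (Y i ⊕ Y i)) :
    IsTransversal (vertexMap e i '' A) ↔ IsTransversal A := by
  simp only [IsTransversal, Set.mem_image]
  constructor
  · rintro ⟨⟨x, (a | a), ha, hx⟩, y, (b | b), hb, hy⟩ <;> simp [vertexMap] at hx hy
    exact ⟨⟨a, ha⟩, b, hb⟩
  · rintro ⟨⟨x, hx⟩, y, hy⟩
    exact ⟨⟨_, _, hx, rfl⟩, _, _, hy, rfl⟩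

theorem IsLocal.rank_eq [Finite X] [Fintype ι] {α : PartitionMonoid X} (hα : IsLocal e α) :
    α.rank = ∑ i, (restrict e α i).rank := by
  have : {A ∈ α.blocks | IsTransversal A} =
      ⋃ i, (vertexMap e i '' ·) '' {A ∈ (restrict e α i).blocks | IsTransversal A} := by
    rw [hα.blocks_eq]
    ext A
    simp only [Set.mem_ofPred_eq, Set.mem_iUnion, Set.mem_image]
    constructor
    · rintro ⟨⟨i, B, hB, rfl⟩, hA⟩
      exact ⟨i, B, ⟨hB, (isTransversal_image i B).1 hA⟩, rfl⟩
    · rintro ⟨i, B, ⟨hB, hA⟩, rfl⟩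
      exact ⟨⟨i, B, hB, rfl⟩, (isTransversal_image i B).2 hA⟩
  rw [rank, this, Set.ncard_iUnion_of_finite (fun i => Set.toFinite _), finsum_eq_sum_of_fintype]
  · refine Finset.sum_congr rfl fun i _ => ?_
    rw [rank, Set.ncard_image_of_injective _ (vertexMap_injective i).image_injective]
  -- Transversal blocks are non-empty, so their images over different summands differ.
  · intro i j hij
    rw [Function.onFun, Set.disjoint_left]
    rintro _ ⟨A, ⟨-, ⟨x, hx⟩, -⟩, rfl⟩ ⟨B, -, hB⟩
    have : vertexMap e i (.inl x) ∈ vertexMap e j '' B := by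
      rw [show vertexMap e j '' B = vertexMap e i '' A from hB]
      exact ⟨_, hx, rfl⟩
    obtain ⟨b, -, hb⟩ := this
    have := congrArg (fun a => (e (proj a)).1) hb
    simp only [fst_proj_vertexMap] at this
    exact hij this.symm

variable (e) in
/-- Idempotents with kernel classes `Y i` correspond to families of irreducible idempotents. -/
theorem bijOn_restrict [Finite X] [Fintype ι] (T : Set ℕ) (r : ℕ) :
    Set.BijOn (restrict e) {α ∈ E (D r (blockSizesIn T X)) | α.ker = fibreSetoid e}
      {β | (∀ i, β i ∈ E (blockSizesIn T (Y i)) ∧ (β i).IsIrreducible) ∧ ∑ i, (β i).rank = r} := by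
  refine ⟨?_, ?_, ?_⟩
  · rintro α ⟨⟨⟨hT, hr⟩, hid⟩, hk⟩
    have hloc := isLocal_of_mul_self hid hk
    exact ⟨fun i => ⟨⟨(hloc.mem_blockSizesIn T).1 hT i, (hloc.mul_self_iff hk).1 hid i⟩,
      hloc.ker_eq_iff.1 hk i⟩, hloc.rank_eq.symm.trans hr⟩
  · rintro α ⟨⟨⟨-, -⟩, hid⟩, hk⟩ β ⟨⟨⟨-, -⟩, hid'⟩, hk'⟩ h
    exact (isLocal_of_mul_self hid hk).eq_of_restrict (isLocal_of_mul_self hid' hk')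
      fun i => congrFun h i
  · rintro β ⟨hβ, hr⟩
    have hloc := isLocal_glue (e := e) β
    have hk : (glue e β).ker = fibreSetoid e :=
      hloc.ker_eq_iff.2 fun i => by rw [restrict_glue]; exact (hβ i).2
    refine ⟨glue e β, ⟨⟨⟨(hloc.mem_blockSizesIn T).2 fun i => ?_, ?_⟩,
      (hloc.mul_self_iff hk).2 fun i => ?_⟩, hk⟩, funext (restrict_glue β)⟩
    · rw [restrict_glue]
      exact (hβ i).1.1
    · rw [hloc.rank_eq]
      simpa only [restrict_glue] using hr
    · rw [restrict_glue]
      exact (hβ i).1.2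

end Decomposition

/-! ### Families of irreducible idempotents of given total rank -/

theorem IsIrreducible.rank_le_one {X : Type*} {α : PartitionMonoid X} (hα : α.IsIrreducible)
    (hid : α * α = α) : α.rank ≤ 1 := by
  have hs : {A ∈ α.blocks | IsTransversal A}.Subsingleton := by
    rintro _ ⟨⟨a, rfl⟩, ⟨x, hx⟩, y, hy⟩ _ ⟨⟨b, rfl⟩, ⟨z, hz⟩, w, hw⟩
    have hxz := ((mul_self_eq_iff α).1 hid).2 x y z w (SameBlock.trans hx (SameBlock.symm hy))
      (SameBlock.trans hz (SameBlock.symm hw)) (Setoid.eq_top_iff.1 hα x z)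
    have hab : α.SameBlock a b := (SameBlock.symm hx).trans (hxz.trans hz)
    ext c
    exact ⟨fun h => SameBlock.trans h hab, fun h => SameBlock.trans h hab.symm⟩
  rw [rank, Set.ncard_le_one hs.finite]
  exact fun a ha b hb => hs ha hb

instance [Finite X] : Finite (PartitionMonoid X) :=
  Finite.of_injective (fun α a b => α.SameBlock a b) fun _ _ h =>
    ext_sameBlock fun a b => iff_of_eq (congrFun (congrFun h a) b)

theorem ncard_pi_univ {ι : Type*} [Fintype ι] {Z : ι → Type*} (S : ∀ i, Set (Z i)) :
    (Set.univ.pi S).ncard = ∏ i, (S i).ncard := by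
  rw [← Nat.card_coe_set_eq, Nat.card_congr (Equiv.Set.univPi S), Nat.card_pi]
  rfl

/-- All ranks are 0 or 1, so the families split according to the `r`-element set `A` of indices of
rank 1; for fixed `A` the components are chosen independently. -/
theorem ncard_families {ι : Type*} [Fintype ι] [DecidableEq ι] {Y : ι → Type*} [∀ i, Finite (Y i)]
    (T : Set ℕ) (r : ℕ) :
    {β : ∀ i, PartitionMonoid (Y i) | (∀ i, β i ∈ E (blockSizesIn T (Y i)) ∧
      (β i).IsIrreducible) ∧ ∑ i, (β i).rank = r}.ncard =
    ∑ A ∈ Finset.powersetCard r (Finset.univ : Finset ι),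
      (∏ i ∈ A, c 1 (blockSizesIn T (Y i))) *
        ∏ j ∈ Finset.univ \ A, c 0 (blockSizesIn T (Y j)) := by
  have hU : {β : ∀ i, PartitionMonoid (Y i) | (∀ i, β i ∈ E (blockSizesIn T (Y i)) ∧
      (β i).IsIrreducible) ∧ ∑ i, (β i).rank = r} =
      ⋃ A ∈ (Finset.powersetCard r (Finset.univ : Finset ι) : Set (Finset ι)),
        Set.univ.pi fun i => C (if i ∈ A then 1 else 0) (blockSizesIn T (Y i)) := by
    ext β
    simp only [Set.mem_ofPred_eq, Set.mem_iUnion, Set.mem_univ_pi, Finset.mem_coe,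
      Finset.mem_powersetCard, Finset.subset_univ, true_and, exists_prop]
    constructor
    · rintro ⟨hβ, hr⟩
      have hle : ∀ i, (β i).rank ≤ 1 := fun i => (hβ i).2.rank_le_one (hβ i).1.2
      have hif : ∀ i, (β i).rank = if (β i).rank = 1 then 1 else 0 := by
        intro i
        have := hle i
        split_ifs <;> omega
      refine ⟨Finset.univ.filter fun i => (β i).rank = 1, ?_, fun i => ⟨(hβ i).1, (hβ i).2, ?_⟩⟩
      · rw [← hr, Finset.card_filter]
        exact Finset.sum_congr rfl fun i _ => (hif i).symm
      · simpa using hif i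
    · rintro ⟨A, hA, hβ⟩
      refine ⟨fun i => ⟨(hβ i).1, (hβ i).2.1⟩, ?_⟩
      rw [Finset.sum_congr rfl fun i _ => (hβ i).2.2]
      simpa using hA
  rw [hU, Set.Finite.ncard_biUnion (Finset.finite_toSet _) (fun _ _ => Set.toFinite _),
    finsum_mem_coe_finset]
  · refine Finset.sum_congr rfl fun A _ => ?_
    rw [ncard_pi_univ, ← Finset.prod_mul_prod_compl A, ← Finset.compl_eq_univ_sdiff]
    congr 1
    · refine Finset.prod_congr rfl fun i hi => ?_
      rw [if_pos hi, c]
    · refine Finset.prod_congr rfl fun i hi => ?_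
      rw [if_neg (Finset.mem_compl.1 hi), c]
  · intro A _ B _ hAB
    rw [Function.onFun, Set.disjoint_left]
    intro β hA hB
    refine hAB (Finset.ext fun i => ?_)
    have h₁ := (hA i trivial).2.2
    have h₂ := (hB i trivial).2.2
    rw [h₁] at h₂
    split_ifs at h₂ <;> simp_all

/-- The number of idempotents of rank `r` whose kernel classes are the fibres of
`X ≃ Σ i, Y i`. -/
theorem ncard_idempotents_ker_eq {X ι : Type*} [Finite X] [Fintype ι] [DecidableEq ι]
    {Y : ι → Type*} [∀ i, Finite (Y i)] (e : X ≃ Σ i, Y i) (T : Set ℕ) (r : ℕ) :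
    {α ∈ E (D r (blockSizesIn T X)) | α.ker = fibreSetoid e}.ncard =
    ∑ A ∈ Finset.powersetCard r (Finset.univ : Finset ι),
      (∏ i ∈ A, c 1 (blockSizesIn T (Y i))) *
        ∏ j ∈ Finset.univ \ A, c 0 (blockSizesIn T (Y j)) := by
  have h := bijOn_restrict e T r
  rw [← ncard_families, ← h.image_eq, h.injOn.ncard_image]

end PartitionMonoid

/-! ### Counting by fibres -/

theorem Set.ncard_eq_sum_ncard_fibre {α β : Type*} [Finite α] {S : Set α} {T : Finset β}
    {f : α → β} (h : ∀ a ∈ S, f a ∈ T) : S.ncard = ∑ b ∈ T, {a ∈ S | f a = b}.ncard := by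
  have hU : S = ⋃ b ∈ (T : Set β), {a ∈ S | f a = b} := by
    ext a
    simp only [Set.mem_iUnion, Set.mem_ofPred_eq, exists_prop, Finset.mem_coe]
    exact ⟨fun ha => ⟨f a, h a ha, ha, rfl⟩, fun ⟨_, _, ha, _⟩ => ha⟩
  conv_lhs => rw [hU]
  rw [Set.Finite.ncard_biUnion T.finite_toSet (fun _ _ => Set.toFinite _), finsum_mem_coe_finset]
  intro b _ c _ hbc
  rw [Function.onFun, Set.disjoint_left]
  exact fun a ha ha' => hbc (ha.2.symm.trans ha'.2)

theorem Set.ncard_eq_mul_of_ncard_fibre {α β : Type*} [Finite α] [Finite β] {S : Set α} {T : Set β}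
    {f : α → β} (h : Set.MapsTo f S T) {N : ℕ} (hN : ∀ b ∈ T, {a ∈ S | f a = b}.ncard = N) :
    S.ncard = T.ncard * N := by
  classical
  have hT := Set.toFinite T
  rw [Set.ncard_eq_sum_ncard_fibre (T := hT.toFinset) (f := f) (fun a ha => by simpa using h ha),
    Finset.sum_congr rfl (fun b hb => hN b (by simpa using hb)), Finset.sum_const,
    Set.ncard_eq_toFinset_card T hT, smul_eq_mul]

theorem exists_equiv_comp_eq {X Y ι : Type*} [Finite X] [Finite Y] (f : X → ι) (g : Y → ι)
    (h : ∀ i, Nat.card {x // f x = i} = Nat.card {y // g y = i}) :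
    ∃ σ : X ≃ Y, ∀ x, g (σ x) = f x := by
  have φ : ∀ i, {x // f x = i} ≃ {y // g y = i} := fun i =>
    Classical.choice (Finite.card_eq.1 (h i))
  refine ⟨(Equiv.sigmaFiberEquiv f).symm.trans
    ((Equiv.sigmaCongrRight φ).trans (Equiv.sigmaFiberEquiv g)), fun x => ?_⟩
  exact (φ (f x) ⟨x, rfl⟩).2

theorem Multiset.count_map_univ {ι : Type*} [Fintype ι] (m : ι → ℕ) (i : ℕ) :
    (Finset.univ.val.map m).count i = Nat.card {j // m j = i} := by
  classical
  rw [Multiset.count_map, Nat.card_eq_fintype_card, Fintype.card_subtype, ← Finset.filter_val]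
  simp only [eq_comm]
  rfl

/-! ### Functions with prescribed fibre sizes -/

namespace PartitionMonoid

/-- The functions with fibres of prescribed sizes. -/
def functionsWithFibres (X : Type*) {ι : Type*} (m : ι → ℕ) : Set (X → ι) :=
  {f | ∀ i, Nat.card {x // f x = i} = m i}

theorem exists_mem_functionsWithFibres {X ι : Type*} [Finite X] [Fintype ι] {m : ι → ℕ}
    (h : Nat.card X = ∑ i, m i) : (functionsWithFibres X m).Nonempty := by
  have : Nat.card X = Nat.card (Σ i, Fin (m i)) := by
    rw [h, Nat.card_sigma]
    simp
  obtain ⟨e⟩ := Finite.card_eq.1 this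
  refine ⟨fun x => (e x).1, fun i => ?_⟩
  rw [Nat.card_congr ((e.subtypeEquiv fun _ => Iff.rfl).trans (Equiv.sigmaSubtype i)),
    Nat.card_fin]

/-- Permutations of `X` act by precomposition. These functions form a single orbit, and a stabilizer
is the product of the symmetric groups of the fibres. -/
theorem ncard_functionsWithFibres {X ι : Type*} [Finite X] [Fintype ι] {m : ι → ℕ}
    (h : Nat.card X = ∑ i, m i) :
    (functionsWithFibres X m).ncard * ∏ i, (m i).factorial = (Nat.card X).factorial := by
  classical
  have := Fintype.ofFinite X
  obtain ⟨f, hf⟩ := exists_mem_functionsWithFibres h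
  have horb : functionsWithFibres X m = MulAction.orbit (Equiv.Perm X)ᵈᵐᵃ f := by
    ext g
    constructor
    · intro hg
      obtain ⟨σ, hσ⟩ := exists_equiv_comp_eq g f fun i => (hg i).trans (hf i).symm
      exact ⟨DomMulAct.mk σ, funext hσ⟩
    · rintro ⟨σ, rfl⟩ i
      rw [← hf i]
      exact Nat.card_congr ((DomMulAct.mk.symm σ).subtypeEquiv fun _ => Iff.rfl)
  have hstab : Nat.card (MulAction.stabilizer (Equiv.Perm X)ᵈᵐᵃ f) = ∏ i, (m i).factorial := by
    rw [Nat.card_congr ((DomMulAct.mk.symm.subtypeEquiv fun g => DomMulAct.mem_stabilizer_iff :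
      MulAction.stabilizer (Equiv.Perm X)ᵈᵐᵃ f ≃ {g : Equiv.Perm X // f ∘ g = f})),
      Nat.card_eq_fintype_card, DomMulAct.stabilizer_card]
    exact Finset.prod_congr rfl fun i _ => by rw [← hf i, Nat.card_eq_fintype_card]
  rw [horb, ← hstab, ← Nat.card_coe_set_eq, ← Nat.card_prod,
    Nat.card_congr (MulAction.orbitProdStabilizerEquivGroup _ f),
    Nat.card_congr DomMulAct.mk.symm, Nat.card_perm]

theorem surjective_of_mem_functionsWithFibres {X ι : Type*} {m : ι → ℕ} (hm : ∀ i, 0 < m i)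
    {f : X → ι} (hf : f ∈ functionsWithFibres X m) : Function.Surjective f := by
  intro i
  have : 0 < Nat.card {x // f x = i} := by rw [hf i]; exact hm i
  obtain ⟨⟨x⟩, -⟩ := Nat.card_pos_iff.1 this
  exact ⟨x.1, x.2⟩

/-- Functions with the kernel of `f` and the same fibre sizes are the relabellings `τ ∘ f` with `m ∘
τ = m`. Positivity of `m` makes `f` surjective, so `τ` is unique. -/
theorem ncard_functionsWithFibres_ker_eq {X ι : Type*} [Finite X] [Finite ι] {m : ι → ℕ}
    (hm : ∀ i, 0 < m i) {f : X → ι} (hf : f ∈ functionsWithFibres X m) :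
    {g ∈ functionsWithFibres X m | Setoid.ker g = Setoid.ker f}.ncard =
      Nat.card {τ : Equiv.Perm ι // m ∘ τ = m} := by
  have hsurj := surjective_of_mem_functionsWithFibres hm hf
  rw [← Nat.card_coe_set_eq]
  symm
  refine Nat.card_congr (Equiv.ofBijective (fun τ => ⟨τ.1 ∘ f, fun i => ?_, ?_⟩) ⟨?_, ?_⟩)
  · rw [Nat.card_congr (Equiv.subtypeEquivRight fun x =>
      show (τ.1 ∘ f) x = i ↔ f x = τ.1.symm i from τ.1.eq_symm_apply.symm), hf]
    simpa using (congrFun τ.2 (τ.1.symm i)).symm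
  · ext x y
    simp [Setoid.ker_def]
  · intro τ τ' h
    have h' : τ.1 ∘ f = τ'.1 ∘ f := congrArg Subtype.val h
    exact Subtype.ext (Equiv.ext fun i => congrFun (hsurj.injective_comp_right h') i)
  · rintro ⟨g, hg, hgf⟩
    have hsurj' := surjective_of_mem_functionsWithFibres hm hg
    have hrel : ∀ x y, g x = g y ↔ f x = f y := fun x y => by
      rw [← Setoid.ker_def, hgf, Setoid.ker_def]
    have hτ : Function.Bijective fun i => g (Function.surjInv hsurj i) := by
      constructor
      · intro i j hij
        rwa [hrel, Function.surjInv_eq hsurj i, Function.surjInv_eq hsurj j] at hij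
      · intro j
        obtain ⟨x, rfl⟩ := hsurj' j
        exact ⟨f x, (hrel _ _).2 (Function.surjInv_eq hsurj _)⟩
    have hcomp : ∀ x, g (Function.surjInv hsurj (f x)) = g x := fun x =>
      (hrel _ _).2 (Function.surjInv_eq hsurj _)
    refine ⟨⟨Equiv.ofBijective _ hτ, ?_⟩, Subtype.ext (funext hcomp)⟩
    funext i
    obtain ⟨x, rfl⟩ := hsurj i
    simp only [Function.comp_apply, Equiv.ofBijective_apply, hcomp]
    rw [← hg, ← hf]
    exact Nat.card_congr (Equiv.subtypeEquivRight fun y => hrel y x)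

theorem card_perm_comp_eq {n : ℕ} {ι : Type*} [Fintype ι] (m : ι → ℕ)
    (hm : ∀ i, m i ∈ Finset.Icc 1 n) :
    Nat.card {τ : Equiv.Perm ι // m ∘ τ = m} =
      ∏ i ∈ Finset.Icc 1 n, ((Finset.univ.val.map m).count i).factorial := by
  classical
  rw [Nat.card_eq_fintype_card, DomMulAct.stabilizer_card']
  refine (Finset.prod_subset (fun i hi => ?_) fun i _ hi => ?_).trans
    (Finset.prod_congr rfl fun i _ => ?_)
  · obtain ⟨j, -, rfl⟩ := Finset.mem_image.1 hi
    exact hm j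
  -- Sizes that do not occur contribute `0! = 1`.
  · have : IsEmpty {a // m a = i} :=
      ⟨fun a => hi (Finset.mem_image.2 ⟨a.1, Finset.mem_univ _, a.2⟩)⟩
    rw [Fintype.card_eq_zero, Nat.factorial_zero]
  · rw [Multiset.count_map_univ, Nat.card_eq_fintype_card]

theorem prod_factorial_eq {n : ℕ} {ι : Type*} [Fintype ι] (m : ι → ℕ)
    (hm : ∀ i, m i ∈ Finset.Icc 1 n) :
    ∏ j, (m j).factorial =
      ∏ i ∈ Finset.Icc 1 n, i.factorial ^ (Finset.univ.val.map m).count i := by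
  classical
  have h : ∏ j, (m j).factorial = ((Finset.univ.val.map m).map Nat.factorial).prod := by
    rw [Multiset.map_map]
    rfl
  rw [h, Finset.prod_multiset_map_count]
  refine Finset.prod_subset (fun i hi => ?_) fun i _ hi => ?_
  · simp only [Multiset.mem_toFinset, Multiset.mem_map] at hi
    obtain ⟨j, -, rfl⟩ := hi
    exact hm j
  · rw [Multiset.count_eq_zero_of_notMem (by simpa using hi), pow_zero]

/-! ### Set partitions as kernels of labellings -/

open Classical in
/-- The set partition of `{1, …, n}` into the classes of an equivalence relation. -/
noncomputable def classPartition {n : ℕ} (s : Setoid (Fin n)) :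
    Finpartition (Finset.univ : Finset (Fin n)) := Finpartition.ofSetoid s

theorem mem_part_classPartition {n : ℕ} {s : Setoid (Fin n)} {a b : Fin n} :
    b ∈ (classPartition s).part a ↔ s a b := by
  classical
  rw [classPartition]
  convert Finpartition.mem_part_ofSetoid_iff_rel

theorem classPartition_injective {n : ℕ} :
    Function.Injective (classPartition : Setoid (Fin n) → _) := by
  intro s t h
  ext a b
  rw [← mem_part_classPartition, h, mem_part_classPartition]

theorem parts_eq_image_part {X : Type*} [Fintype X] [DecidableEq X]
    (Q : Finpartition (Finset.univ : Finset X)) : Q.parts = Finset.univ.image Q.part := by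
  ext A
  rw [Finset.mem_image]
  constructor
  · intro hA
    obtain ⟨x, hx⟩ := Q.nonempty_of_mem_parts hA
    exact ⟨x, Finset.mem_univ _, Q.part_eq_of_mem hA hx⟩
  · rintro ⟨x, -, rfl⟩
    exact Q.part_mem.2 (Finset.mem_univ x)

theorem eq_classPartition {n : ℕ} {Q : Finpartition (Finset.univ : Finset (Fin n))}
    {s : Setoid (Fin n)} (h : ∀ a b, b ∈ Q.part a ↔ s a b) : classPartition s = Q := by
  have : (classPartition s).part = Q.part := by
    funext a
    ext b
    rw [mem_part_classPartition, h]
  exact Finpartition.ext (by rw [parts_eq_image_part, parts_eq_image_part, this])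

theorem parts_classPartition_ker {n k : ℕ} {f : Fin n → Fin k} (hf : Function.Surjective f) :
    (classPartition (Setoid.ker f)).parts =
      Finset.univ.image fun i => Finset.univ.filter fun x => f x = i := by
  have h : (classPartition (Setoid.ker f)).part =
      (fun i => Finset.univ.filter fun x => f x = i) ∘ f := by
    funext x
    ext y
    rw [mem_part_classPartition, Setoid.ker_def]
    simp [eq_comm]
  rw [parts_eq_image_part, h, ← Finset.image_image, Finset.image_univ_of_surjective hf]

theorem setPartitionType_classPartition_ker {n k : ℕ} {μ : n.Partition} {m : Fin k → ℕ}
    (hμ : μ.parts = Finset.univ.val.map m) (hm : ∀ i, 0 < m i) {f : Fin n → Fin k}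
    (hf : f ∈ functionsWithFibres (Fin n) m) :
    setPartitionType (classPartition (Setoid.ker f)) = μ := by
  have hsurj := surjective_of_mem_functionsWithFibres hm hf
  apply Nat.Partition.ext
  change (classPartition (Setoid.ker f)).parts.val.map Finset.card = _
  rw [hμ, parts_classPartition_ker hsurj, Finset.image_val_of_injOn, Multiset.map_map]
  · refine Multiset.map_congr rfl fun i _ => ?_
    rw [← hf i, Nat.card_eq_fintype_card, Fintype.card_subtype]
    rfl
  -- Fibres are non-empty, so distinct labels give distinct parts and no multiplicity is lost in the
  -- image.
  · intro i _ j _ hij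
    obtain ⟨x, rfl⟩ := hsurj i
    simpa using congrArg (x ∈ ·) hij

/-- The part sizes of `Q` and the values of `m` form the same multiset, so some bijection from the
parts to `Fin k` matches sizes; label each point by its part. -/
theorem exists_classPartition_ker_eq {n k : ℕ} {μ : n.Partition} {m : Fin k → ℕ}
    (hμ : μ.parts = Finset.univ.val.map m) {Q : Finpartition (Finset.univ : Finset (Fin n))}
    (hQ : setPartitionType Q = μ) :
    ∃ f ∈ functionsWithFibres (Fin n) m, classPartition (Setoid.ker f) = Q := by
  have hparts : Finset.univ.val.map (fun A : Q.parts => A.1.card) = Finset.univ.val.map m := by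
    rw [← hμ, ← hQ, setPartitionType, Finset.univ_eq_attach, Finset.attach_val]
    exact Multiset.attach_map_val' _ Finset.card
  obtain ⟨σ, hσ⟩ := exists_equiv_comp_eq (fun A : Q.parts => A.1.card) m fun i => by
    rw [← Multiset.count_map_univ, hparts, Multiset.count_map_univ]
  have hmem : ∀ x, Q.part x ∈ Q.parts := fun x => Q.part_mem.2 (Finset.mem_univ x)
  refine ⟨fun x => σ ⟨Q.part x, hmem x⟩, fun i => ?_, eq_classPartition fun a b => ?_⟩
  · obtain ⟨⟨A, hA⟩, rfl⟩ := σ.surjective i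
    rw [hσ, ← Nat.card_eq_finsetCard]
    refine Nat.card_congr (Equiv.subtypeEquivRight fun x => ?_)
    rw [σ.apply_eq_iff_eq, Subtype.mk.injEq, Q.part_eq_iff_mem hA]
  · rw [Setoid.ker_def, σ.apply_eq_iff_eq, Subtype.mk.injEq,
      ← Q.mem_part_iff_part_eq_part (Finset.mem_univ _) (Finset.mem_univ _),
      Q.mem_part_iff_part_eq_part (Finset.mem_univ _) (Finset.mem_univ _),
      Q.mem_part_iff_part_eq_part (Finset.mem_univ _) (Finset.mem_univ _), eq_comm]

end PartitionMonoid
-- The number of set partitions of a given type, and the final formula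
namespace PartitionMonoid

theorem mem_Icc_of_parts {n : ℕ} {ι : Type*} [Fintype ι] {μ : n.Partition} {m : ι → ℕ}
    (hμ : μ.parts = Finset.univ.val.map m) (i : ι) : m i ∈ Finset.Icc 1 n := by
  have hi : m i ∈ μ.parts := by
    rw [hμ]
    exact Multiset.mem_map_of_mem m (Finset.mem_univ_val i)
  exact Finset.mem_Icc.2 ⟨μ.parts_pos hi, μ.le_of_mem_parts hi⟩

theorem card_eq_sum_of_parts {n : ℕ} {ι : Type*} [Fintype ι] {μ : n.Partition} {m : ι → ℕ}
    (hμ : μ.parts = Finset.univ.val.map m) : Nat.card (Fin n) = ∑ i, m i := by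
  rw [Nat.card_fin]
  have h := μ.parts_sum
  rw [hμ] at h
  exact h.symm

/-- Double count of the functions with fibre sizes `m`: directly, and by sending each to the set
partition into its fibres. -/
theorem numSetPartitions_mul {n : ℕ} (μ : n.Partition) :
    numSetPartitions μ * ∏ i ∈ Finset.Icc 1 n,
      ((μ.parts.count i).factorial * i.factorial ^ μ.parts.count i) = n.factorial := by
  obtain ⟨k, m, hμ⟩ : ∃ (k : ℕ) (m : Fin k → ℕ), μ.parts = Finset.univ.val.map m :=
    ⟨_, μ.parts.toList.get, by
      conv_lhs => rw [← Multiset.coe_toList μ.parts, ← List.ofFn_get μ.parts.toList]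
      rw [Fin.univ_val_map]⟩
  have hIcc := mem_Icc_of_parts hμ
  have hm : ∀ i, 0 < m i := fun i => (Finset.mem_Icc.1 (hIcc i)).1
  have hF : (functionsWithFibres (Fin n) m).ncard =
      numSetPartitions μ * Nat.card {τ : Equiv.Perm (Fin k) // m ∘ τ = m} := by
    refine Set.ncard_eq_mul_of_ncard_fibre (f := fun f => classPartition (Setoid.ker f))
      (fun f hf => setPartitionType_classPartition_ker hμ hm hf) fun Q hQ => ?_
    obtain ⟨f, hf, rfl⟩ := exists_classPartition_ker_eq hμ hQ
    simp only [classPartition_injective.eq_iff]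
    exact ncard_functionsWithFibres_ker_eq hm hf
  have h := ncard_functionsWithFibres (card_eq_sum_of_parts hμ)
  rw [hF, card_perm_comp_eq m hIcc, prod_factorial_eq m hIcc, Nat.card_fin, ← hμ, mul_assoc,
    ← Finset.prod_mul_distrib] at h
  exact h

theorem eType_eq {n k : ℕ} {μ : n.Partition} {m : Fin k → ℕ}
    (hμ : μ.parts = Finset.univ.val.map m) (T : Set ℕ) (r : ℕ) :
    eType μ (D r (blockSizesIn T (Fin n))) = numSetPartitions μ *
      ∑ A ∈ Finset.powersetCard r (Finset.univ : Finset (Fin k)),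
        (∏ i ∈ A, c 1 (blockSizesIn T (Fin (m i)))) *
          ∏ j ∈ Finset.univ \ A, c 0 (blockSizesIn T (Fin (m j))) := by
  refine Set.ncard_eq_mul_of_ncard_fibre (f := fun α => classPartition α.ker)
    (fun α hα => hα.2) fun Q hQ => ?_
  obtain ⟨f, hf, rfl⟩ := exists_classPartition_ker_eq hμ hQ
  -- Identifying the `i`-th class with `Fin (m i)` makes the count visibly independent of `Q`.
  obtain ⟨e, he⟩ := exists_equiv_comp_eq f (Sigma.fst : (Σ i, Fin (m i)) → Fin k) fun i => by
    rw [hf i, Nat.card_congr (Equiv.sigmaSubtype i), Nat.card_fin]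
  have hs : Setoid.ker f = fibreSetoid e := by
    ext x y
    rw [fibreSetoid, Setoid.ker_def, Setoid.ker_def, he, he]
  rw [← ncard_idempotents_ker_eq e T r, ← hs]
  congr 1
  ext α
  simp only [Set.mem_ofPred_eq, classPartition_injective.eq_iff]
  refine ⟨fun h => ⟨h.1.1, h.2⟩, fun h => ⟨⟨h.1, ?_⟩, h.2⟩⟩
  rw [← hQ, ← h.2]
  rfl

theorem e_eq_sum_eType {n : ℕ} (S : Set (PartitionMonoid (Fin n))) :
    e S = ∑ μ : n.Partition, eType μ S :=
  Set.ncard_eq_sum_ncard_fibre fun _ _ => Finset.mem_univ _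

/-- One set `T` of allowed block sizes serves all degrees at once, so the three monoids are treated
uniformly and restriction to a kernel class stays in the same family. -/
theorem exists_eq_blockSizesIn {K : (n : ℕ) → Set (PartitionMonoid (Fin n))}
    (hK : K = P ∨ K = B ∨ K = PB) : ∃ T, K = fun n => blockSizesIn T (Fin n) := by
  rcases hK with rfl | rfl | rfl
  · exact ⟨Set.univ, funext fun n => by simp [P, blockSizesIn, Set.ofPred_true]⟩
  · exact ⟨{2}, rfl⟩
  · exact ⟨Set.Iic 2, rfl⟩

end PartitionMonoid

theorem mainTheorem3 (K : (n : ℕ) → Set (PartitionMonoid (Fin n)))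
    (hK : K = PartitionMonoid.P ∨ K = PartitionMonoid.B ∨ K = PartitionMonoid.PB)
    (n r : ℕ) (hr : r ≤ n) :
    PartitionMonoid.e (PartitionMonoid.D r (K n)) =
        ∑ μ : n.Partition, PartitionMonoid.eType μ (PartitionMonoid.D r (K n)) ∧
    ∀ μ : n.Partition,
      (PartitionMonoid.numSetPartitions μ : ℚ) =
        (n.factorial : ℚ) / ∏ i ∈ Finset.Icc 1 n,
          (((μ.parts.count i).factorial : ℚ) * (i.factorial : ℚ) ^ (μ.parts.count i)) ∧
      ∀ (k : ℕ) (m : Fin k → ℕ), Antitone m → μ.parts = (Finset.univ : Finset (Fin k)).val.map m →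
        (PartitionMonoid.eType μ (PartitionMonoid.D r (K n)) : ℚ) =
          ((n.factorial : ℚ) / ∏ i ∈ Finset.Icc 1 n,
            (((μ.parts.count i).factorial : ℚ) * (i.factorial : ℚ) ^ (μ.parts.count i))) *
          ∑ A ∈ Finset.powersetCard r (Finset.univ : Finset (Fin k)),
            ((∏ i ∈ A, (PartitionMonoid.c 1 (K (m i)) : ℚ)) *
              ∏ j ∈ Finset.univ \ A, (PartitionMonoid.c 0 (K (m j)) : ℚ)) := by
  obtain ⟨T, rfl⟩ := PartitionMonoid.exists_eq_blockSizesIn hK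
  refine ⟨PartitionMonoid.e_eq_sum_eType _, fun μ => ?_⟩
  have hπ : (PartitionMonoid.numSetPartitions μ : ℚ) =
      (n.factorial : ℚ) / ∏ i ∈ Finset.Icc 1 n,
        (((μ.parts.count i).factorial : ℚ) * (i.factorial : ℚ) ^ (μ.parts.count i)) := by
    rw [eq_div_iff (Finset.prod_ne_zero_iff.2 fun i _ => by positivity)]
    exact_mod_cast PartitionMonoid.numSetPartitions_mul μ
  refine ⟨hπ, fun k m _ hμ => ?_⟩
  rw [← hπ, PartitionMonoid.eType_eq hμ T r]
  push_cast
  rfl
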